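/- Let $\mathbb D$ be the open unit disc in $\mathbb C$ and let $T=(\mathbb D\times\{0\})\cup(\{0\}\times\mathbb D)\subset\mathbb C^2$. A function $f:V\to\mathbb C$ on a set $V\subseteq\mathbb C^n$ is called holomorphic on $V$ if near each point of $V$ it is the restriction of a holomorphic function on an open subset of $\mathbb C^n$; $H^\infty(V)$ is the space of bounded holomorphic functions on $V$ with the norm $\|f\|_V=\sup_V|f|$. A pair $(\Omega,V)$ has the linear norm preserving extension property if $\Omega\subseteq\mathbb C^n$ is a domain of holomorphy (in particular, nonempty, open and connected), $V$ is an analytic set in $\Omega$ (a relatively closed subset which near each of its points is the common zero set of finitely many holomorphic functions), and there is a linear isometry $E:H^\infty(V)\to H^\infty(\Omega)$ with $(Ef)(\lambda)=f(\lambda)$ for all $\lambda\in V$. Theorem. There is a domain of holomorphy $G\subseteq\mathbb C^2$ containing $T$ such that $(G,T)$ has the linear norm preserving extension property. Explicitly, for $f\in H^\infty(T)$ and $\lambda=(\lambda_1,\lambda_2)\in\mathbb D^2$ put $$(Ef)(\lambda)=f(\lambda_1,0)+f(0,\lambda_2)-f(0,0)$$ (that is, $(Ef)(\lambda)=f_1(\lambda_1)+f_2(\lambda_2)-f_1(0)$,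 where $f_1(z)=f(z,0)$ and $f_2(z)=f(0,z)$). Then one can take for $G$ the interior of $$\bigcap_{f\in H^\infty(T),\ f\text{ non-constant}}\{\lambda\in\mathbb D^2:\ |(Ef)(\lambda)|<\|f\|_T\}:$$ this $G$ is a domain of holomorphy containing $T$, and $f\mapsto (Ef)|_G$ is a linear isometry of $H^\infty(T)$ into $H^\infty(G)$ with $(Ef)|_T=f$. -/

import Mathlib

open scoped BoundedContinuousFunction

/-- A domain of holomorphy in `ℂⁿ`: a (nonempty, connected, open) domain `Ω` for which there are
no open `U`, `W` with `∅ ≠ U ⊆ W ∩ Ω`, `W` connected and not contained in `Ω`, such that every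
holomorphic function on `Ω` agrees on `U` with some holomorphic function on `W`. -/
def IsDomainOfHolomorphy {n : ℕ} (Ω : Set (Fin n → ℂ)) : Prop :=
  IsOpen Ω ∧ IsConnected Ω ∧
    ¬ ∃ U W : Set (Fin n → ℂ), IsOpen U ∧ IsOpen W ∧ U.Nonempty ∧ U ⊆ W ∩ Ω ∧
      IsConnected W ∧ ¬ W ⊆ Ω ∧
      ∀ u : (Fin n → ℂ) → ℂ, DifferentiableOn ℂ u Ω →
        ∃ v : (Fin n → ℂ) → ℂ, DifferentiableOn ℂ v W ∧ Set.EqOn u v U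

/-- `V` is an analytic set in `Ω`: a relatively closed subset of `Ω` that, near each of its
points, is the common zero set of finitely many holomorphic functions. -/
def IsAnalyticSetIn {n : ℕ} (Ω V : Set (Fin n → ℂ)) : Prop :=
  V ⊆ Ω ∧ (∃ C : Set (Fin n → ℂ), IsClosed C ∧ V = C ∩ Ω) ∧
    ∀ x ∈ V, ∃ U : Set (Fin n → ℂ), IsOpen U ∧ x ∈ U ∧
      ∃ (m : ℕ) (f : Fin m → (Fin n → ℂ) → ℂ),
        (∀ i, DifferentiableOn ℂ (f i) U) ∧ V ∩ U = {y ∈ U | ∀ i, f i y = 0}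

/-- `(Ω, V)` is a Cartan pair. -/
def IsCartanPair {n : ℕ} (Ω V : Set (Fin n → ℂ)) : Prop :=
  IsDomainOfHolomorphy Ω ∧ IsAnalyticSetIn Ω V

/-- A function `f : V → ℂ` on a subset `V` of `ℂⁿ` is holomorphic on `V` if near each point of `V`
it is the restriction of a holomorphic function on an open subset of `ℂⁿ`. -/
def HolomorphicOnSet {n : ℕ} {V : Set (Fin n → ℂ)} (f : V → ℂ) : Prop :=
  ∀ x : V, ∃ U : Set (Fin n → ℂ), IsOpen U ∧ (x : Fin n → ℂ) ∈ U ∧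
    ∃ F : (Fin n → ℂ) → ℂ, DifferentiableOn ℂ F U ∧
      ∀ y : V, (y : Fin n → ℂ) ∈ U → F y = f y

/-- The space `H^∞(V)` of bounded holomorphic functions on `V`, with the supremum norm (inherited
from the space of bounded continuous functions; holomorphic functions on `V` are continuous). -/
def Hinf {n : ℕ} (V : Set (Fin n → ℂ)) : Submodule ℂ (V →ᵇ ℂ) where
  carrier := {f | HolomorphicOnSet (f : V → ℂ)}
  zero_mem' := fun _ => ⟨Set.univ, isOpen_univ, trivial, fun _ => 0,
    differentiableOn_const 0, fun _ _ => rfl⟩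
  add_mem' := by
    intro f g hf hg x
    obtain ⟨U, hU, hxU, F, hF, hFf⟩ := hf x
    obtain ⟨W, hW, hxW, K, hK, hKg⟩ := hg x
    refine ⟨U ∩ W, hU.inter hW, ⟨hxU, hxW⟩, fun y => F y + K y,
      (hF.mono Set.inter_subset_left).add (hK.mono Set.inter_subset_right), fun y hy => ?_⟩
    simp [hFf y hy.1, hKg y hy.2]
  smul_mem' := by
    intro c f hf x
    obtain ⟨U, hU, hxU, F, hF, hFf⟩ := hf x
    refine ⟨U, hU, hxU, fun y => c * F y, hF.const_mul c, fun y hy => ?_⟩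
    simp [hFf y hy]

/-- Every bounded holomorphic function on `V` is an element of `Hinf V`. -/
theorem exists_mem_Hinf {n : ℕ} {V : Set (Fin n → ℂ)} (f : V → ℂ) (hf : HolomorphicOnSet f)
    (C : ℝ) (hC : ∀ x, ‖f x‖ ≤ C) : ∃ g : Hinf V, ∀ x, (g : V →ᵇ ℂ) x = f x := by
  have hcont : Continuous f := by
    rw [continuous_iff_continuousAt]
    intro x
    obtain ⟨U, hU, hxU, F, hF, hFf⟩ := hf x
    have h1 : ContinuousAt (fun y : V => F y) x :=
      ContinuousAt.comp (f := fun y : V => (y : Fin n → ℂ)) (g := F)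
        (hF.continuousOn.continuousAt (hU.mem_nhds hxU)) continuous_subtype_val.continuousAt
    refine h1.congr ?_
    filter_upwards [(hU.preimage continuous_subtype_val).mem_nhds hxU] with y hy
    exact hFf y hy
  exact ⟨⟨BoundedContinuousFunction.ofNormedAddCommGroup f hcont C hC, hf⟩, fun _ => rfl⟩

/-- `(Ω, V)` has the linear norm preserving extension property: it is a Cartan pair and there is a
linear isometry `E : H^∞(V) → H^∞(Ω)` with `E f = f` on `V`. -/
def HasLinearNormPreservingExtension {n : ℕ} (Ω V : Set (Fin n → ℂ)) : Prop :=
  IsCartanPair Ω V ∧ ∃ E : Hinf V →ₗᵢ[ℂ] Hinf Ω,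
    ∀ (f : Hinf V) (x : Fin n → ℂ) (hV : x ∈ V) (hΩ : x ∈ Ω),
      (E f : Ω →ᵇ ℂ) ⟨x, hΩ⟩ = (f : V →ᵇ ℂ) ⟨x, hV⟩

/-- The open bidisc in `ℂ²`. -/
def bidisc : Set (Fin 2 → ℂ) := {x | ‖x 0‖ < 1 ∧ ‖x 1‖ < 1}

/-- The two crossed discs `T = 𝔻 × {0} ∪ {0} × 𝔻` in `ℂ²`. -/
def crossedDiscs : Set (Fin 2 → ℂ) := {x | (‖x 0‖ < 1 ∧ x 1 = 0) ∨ (x 0 = 0 ∧ ‖x 1‖ < 1)}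

theorem fst_mem_crossedDiscs {z : ℂ} (hz : ‖z‖ < 1) : ![z, 0] ∈ crossedDiscs :=
  Or.inl ⟨hz, rfl⟩

theorem snd_mem_crossedDiscs {z : ℂ} (hz : ‖z‖ < 1) : ![0, z] ∈ crossedDiscs :=
  Or.inr ⟨rfl, hz⟩

/-- For `f : T → ℂ`, the function `λ ↦ f(λ₁, 0) + f(0, λ₂) - f(0, 0)` on the bidisc. -/
def crossExtension (f : crossedDiscs → ℂ) (x : bidisc) : ℂ :=
  f ⟨![x.1 0, 0], fst_mem_crossedDiscs x.2.1⟩ + f ⟨![0, x.1 1], snd_mem_crossedDiscs x.2.2⟩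
    - f ⟨![0, 0], fst_mem_crossedDiscs (by simp)⟩

/-- If `f(z, 0) = f₁(z)` and `f(0, z) = f₂(z)` for `z ∈ 𝔻`, then the function above is
`λ ↦ f₁(λ₁) + f₂(λ₂) - f₁(0)`. -/
theorem crossExtension_eq (f : crossedDiscs → ℂ) (f₁ f₂ : ℂ → ℂ)
    (h₁ : ∀ (z : ℂ) (hz : ‖z‖ < 1), f ⟨![z, 0], fst_mem_crossedDiscs hz⟩ = f₁ z)
    (h₂ : ∀ (z : ℂ) (hz : ‖z‖ < 1), f ⟨![0, z], snd_mem_crossedDiscs hz⟩ = f₂ z) (x : bidisc) :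
    crossExtension f x = f₁ (x.1 0) + f₂ (x.1 1) - f₁ 0 := by
  simp only [crossExtension]
  rw [h₁ _ x.2.1, h₂ _ x.2.2, h₁ 0 (by simp)]

/-- The interior of the set of all `λ` in the bidisc such that
`|f(λ₁, 0) + f(0, λ₂) - f(0, 0)| < ‖f‖` for every nonconstant `f ∈ H^∞(T)`. -/
def crossDomain : Set (Fin 2 → ℂ) :=
  interior {x | ∃ hx : x ∈ bidisc, ∀ f : Hinf crossedDiscs,
    (¬ ∃ c : ℂ, ∀ y, (f : crossedDiscs →ᵇ ℂ) y = c) →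
      ‖crossExtension (f : crossedDiscs →ᵇ ℂ) ⟨x, hx⟩‖ < ‖f‖}

theorem crossDomain_subset_bidisc : crossDomain ⊆ bidisc :=
  fun _ hx => (interior_subset hx).1

/-! The domain is explicit: it is the Reinhardt domain `crossRegion`, on which `r + s + 3rs < 1`
with `r = |λ₁|`, `s = |λ₂|`. Normalise `‖f‖ = 1` and put `a = f(0,0)`. By Schwarz–Pick, `f₁(λ₁)` and
`f₂(λ₂)` lie in the pseudohyperbolic discs about `a` of radii `r` and `s`. These are Euclidean discs
centred on the real line through `a`, so `|f₁ + f₂ - a|` is largest on that line, where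
`one_sub_add_div_add_div` computes the bound: it is below `1` when `r + s + (2β + β²)rs < 1` for `β
= ±|a|`. Since `2β + β² < 3`, the region suffices (`norm_crossExtension_lt`). Conversely `2β + β² →
3` as `β → 1`, and rotated Möbius maps attain the bound, so no point with `r + s + 3rs > 1` survives
(`exists_crossExtension_norm_ge`). -/

open Set Metric Filter Topology ComplexConjugate

/-! ### Identity theorem and rotation onto the positive axis. -/

/-- **Identity theorem** for complex differentiable functions on a connected open subset of a
complex normed space. -/
theorem DifferentiableOn.eqOn_of_isPreconnected_of_eventuallyEq {E : Type*}
    [NormedAddCommGroup E] [NormedSpace ℂ E] {f g : E → ℂ} {W : Set E} (hf : DifferentiableOn ℂ f W)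
    (hg : DifferentiableOn ℂ g W) (hW : IsOpen W) (hc : IsPreconnected W) {x : E} (hx : x ∈ W)
    (h : f =ᶠ[𝓝 x] g) : EqOn f g W := by
  have hA : IsOpen {y | f =ᶠ[𝓝 y] g} := isOpen_setOfPred_eventually_nhds
  have hsub : W ⊆ {y | f =ᶠ[𝓝 y] g} := by
    refine hc.subset_of_closure_inter_subset hA ⟨x, hx, h⟩ ?_
    rintro y ⟨hy, hyW⟩
    obtain ⟨ε, hε, hball⟩ := Metric.isOpen_iff.1 hW y hyW
    obtain ⟨y', hy', hyy'⟩ := Metric.mem_closure_iff.1 hy ε hε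
    have hy'b : y' ∈ ball y ε := by rwa [mem_ball, dist_comm]
    have key : ∀ z ∈ ball y ε, f z = g z := by
      intro z hz
      -- Restricting to the complex line through `y'` and `z` reduces the claim to one variable; the
      -- ball cuts this line in a convex set.
      let l : ℂ → E := fun t => y' + t • (z - y')
      have hl : Differentiable ℂ l := by fun_prop
      have hS : IsOpen (l ⁻¹' ball y ε) := isOpen_ball.preimage hl.continuous
      have hSc : Convex ℝ (l ⁻¹' ball y ε) := by
        intro t ht s hs a b ha hb hab
        have e : l (a • t + b • s) = a • l t + b • l s := by
          have e' : y' = a • y' + b • y' := by rw [← add_smul, hab, one_smul]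
          simp only [l, add_smul, smul_add, smul_assoc]
          nth_rewrite 1 [e']
          abel
        rw [mem_preimage, e]
        exact convex_ball y ε ht hs ha hb hab
      have hfl : DifferentiableOn ℂ (f ∘ l) (l ⁻¹' ball y ε) :=
        (hf.mono hball).comp hl.differentiableOn (mapsTo_preimage _ _)
      have hgl : DifferentiableOn ℂ (g ∘ l) (l ⁻¹' ball y ε) :=
        (hg.mono hball).comp hl.differentiableOn (mapsTo_preimage _ _)
      have h0 : l 0 = y' := by simp [l]
      have h1 : l 1 = z := by simp [l]
      have hev : f ∘ l =ᶠ[𝓝 0] g ∘ l := by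
        have ht : Tendsto l (𝓝 0) (𝓝 y') := by
          simpa [h0] using hl.continuous.tendsto 0
        exact ht.eventually hy'
      have := (hfl.analyticOnNhd hS).eqOn_of_preconnected_of_eventuallyEq
        (hgl.analyticOnNhd hS) hSc.isPreconnected (z₀ := 0) (by simpa [h0] using hy'b) hev
        (x := 1) (by simpa [h1] using hz)
      simpa [h1] using this
    exact Filter.eventually_of_mem (ball_mem_nhds y hε) key
  exact fun y hy => (hsub hy).self_of_nhds

theorem Complex.exists_norm_eq_one_mul_eq_norm (w : ℂ) : ∃ u : ℂ, ‖u‖ = 1 ∧ u * w = ‖w‖ := by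
  rcases eq_or_ne w 0 with rfl | hw
  · exact ⟨1, by simp⟩
  · have hw' : ‖w‖ ≠ 0 := norm_ne_zero_iff.2 hw
    refine ⟨‖w‖ / w, ?_, div_mul_cancel₀ _ hw⟩
    simp [hw']

/-! ### The Reinhardt domain. -/

/-- The Reinhardt domain `|x₁| + |x₂| + 3 |x₁| |x₂| < 1`. -/
def crossRegion : Set (Fin 2 → ℂ) := {x | ‖x 0‖ + ‖x 1‖ + 3 * (‖x 0‖ * ‖x 1‖) < 1}

theorem isOpen_crossRegion : IsOpen crossRegion :=
  isOpen_lt (by fun_prop) continuous_const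

theorem isOpen_bidisc : IsOpen bidisc :=
  (isOpen_lt (f := fun x : Fin 2 → ℂ => ‖x 0‖) (by fun_prop) continuous_const).inter
    (isOpen_lt (f := fun x : Fin 2 → ℂ => ‖x 1‖) (by fun_prop) continuous_const)

theorem crossRegion_subset_bidisc : crossRegion ⊆ bidisc := by
  intro x hx
  have h0 := norm_nonneg (x 0)
  have h1 := norm_nonneg (x 1)
  have h2 := mul_nonneg h0 h1
  simp only [crossRegion, mem_ofPred_eq] at hx
  exact ⟨by linarith, by linarith⟩

theorem crossedDiscs_subset_crossRegion : crossedDiscs ⊆ crossRegion := by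
  rintro x (⟨h, h'⟩ | ⟨h, h'⟩)
  · simpa [crossRegion, h'] using h
  · simpa [crossRegion, h] using h'

theorem isConnected_crossRegion : IsConnected crossRegion := by
  have h0 : (0 : Fin 2 → ℂ) ∈ crossRegion := by simp [crossRegion]
  have hstar : StarConvex ℝ (0 : Fin 2 → ℂ) crossRegion := by
    rw [starConvex_zero_iff]
    intro x hx a ha0 ha1
    have h0 := norm_nonneg (x 0)
    have h1 := norm_nonneg (x 1)
    simp only [crossRegion, mem_ofPred_eq, Pi.smul_apply, norm_smul, Real.norm_eq_abs,
      abs_of_nonneg ha0] at hx ⊢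
    refine lt_of_le_of_lt ?_ hx
    have e0 := mul_le_of_le_one_left h0 ha1
    have e1 := mul_le_of_le_one_left h1 ha1
    gcongr
  exact (hstar.isPathConnected h0).isConnected

/-- For each `p` outside the region, a polynomial `q` vanishes at `p` but nowhere in the region. A
continuation `v` of `1/q` to `W ∋ p` would satisfy `v q = 1` on `W` by the identity theorem, which
fails at `p`. -/
theorem isDomainOfHolomorphy_crossRegion : IsDomainOfHolomorphy crossRegion := by
  refine ⟨isOpen_crossRegion, isConnected_crossRegion, ?_⟩
  rintro ⟨U, W, hU, hW, ⟨x, hx⟩, hUW, hWc, hWG, hext⟩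
  obtain ⟨p, hpW, hpG⟩ := not_subset.1 hWG
  obtain ⟨a, ha, hap⟩ := Complex.exists_norm_eq_one_mul_eq_norm (p 0)
  obtain ⟨b, hb, hbp⟩ := Complex.exists_norm_eq_one_mul_eq_norm (p 1)
  let t : ℝ := ‖p 0‖ + ‖p 1‖ + 3 * (‖p 0‖ * ‖p 1‖)
  have ht : 1 ≤ t := not_lt.1 hpG
  -- The rotations `a`, `b` turn the coordinates of `p` into their moduli; in the region the
  -- subtracted term has modulus below `1 ≤ t`.
  let q : (Fin 2 → ℂ) → ℂ := fun y => t - (a * y 0 + b * y 1 + 3 * ((a * y 0) * (b * y 1)))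
  have hq : Differentiable ℂ q := by fun_prop
  have hqp : q p = 0 := by
    simp only [q, hap, hbp, t]
    push_cast
    ring
  have hqG : ∀ y ∈ crossRegion, q y ≠ 0 := by
    intro y hy h
    have h' : ‖(t : ℂ)‖ = ‖a * y 0 + b * y 1 + 3 * ((a * y 0) * (b * y 1))‖ := by
      rw [sub_eq_zero.1 h]
    have hle : ‖a * y 0 + b * y 1 + 3 * ((a * y 0) * (b * y 1))‖
        ≤ ‖y 0‖ + ‖y 1‖ + 3 * (‖y 0‖ * ‖y 1‖) := by
      refine (norm_add₃_le).trans ?_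
      simp [ha, hb]
    rw [← h', Complex.norm_real, Real.norm_of_nonneg (by linarith)] at hle
    simp only [crossRegion, mem_ofPred_eq] at hy
    linarith
  obtain ⟨v, hv, huv⟩ := hext (fun y => (q y)⁻¹) (hq.differentiableOn.inv hqG)
  have hone : EqOn (fun y => v y * q y) (fun _ => 1) W := by
    refine (hv.mul hq.differentiableOn).eqOn_of_isPreconnected_of_eventuallyEq
      (differentiableOn_const _) hW hWc.isPreconnected (hUW hx).1 ?_
    filter_upwards [hU.mem_nhds hx] with y hy
    have e : (q y)⁻¹ = v y := huv hy
    rw [Pi.mul_apply, ← e, inv_mul_cancel₀ (hqG y (hUW hy).2)]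
  simpa [hqp] using hone hpW

theorem isAnalyticSetIn_crossedDiscs : IsAnalyticSetIn crossRegion crossedDiscs := by
  have key : ∀ x ∈ crossRegion, x 0 * x 1 = 0 → x ∈ crossedDiscs := by
    intro x hx h
    have hb := crossRegion_subset_bidisc hx
    rcases mul_eq_zero.1 h with h | h
    · exact Or.inr ⟨h, hb.2⟩
    · exact Or.inl ⟨hb.1, h⟩
  have key' : ∀ x ∈ crossedDiscs, x 0 * x 1 = 0 := by
    rintro x (⟨-, h⟩ | ⟨h, -⟩) <;> simp [h]
  refine ⟨crossedDiscs_subset_crossRegion, ⟨{x | x 0 * x 1 = 0},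
    isClosed_eq (by fun_prop) continuous_const, ?_⟩, fun x hx => ?_⟩
  · ext x
    exact ⟨fun hx => ⟨key' x hx, crossedDiscs_subset_crossRegion hx⟩, fun hx => key x hx.2 hx.1⟩
  · refine ⟨crossRegion, isOpen_crossRegion, crossedDiscs_subset_crossRegion hx, 1,
      fun _ x => x 0 * x 1, fun _ => Differentiable.differentiableOn (by fun_prop), ?_⟩
    ext x
    exact ⟨fun hx => ⟨hx.2, fun _ => key' x hx.1⟩, fun hx => ⟨key x hx.1 (hx.2 0), hx.1⟩⟩

/-! ### Schwarz–Pick estimates for the sum. -/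

/-- **Schwarz–Pick lemma** at the centre of the disc. -/
theorem Complex.norm_sub_le_mul_of_mapsTo_ball {f : ℂ → ℂ} (hf : DifferentiableOn ℂ f (ball 0 1))
    (hmaps : MapsTo f (ball 0 1) (closedBall 0 1)) (h0 : ‖f 0‖ < 1) {z : ℂ} (hz : ‖z‖ < 1) :
    ‖f z - f 0‖ ≤ ‖z‖ * ‖1 - conj (f 0) * f z‖ := by
  have hne : ∀ w ∈ ball (0 : ℂ) 1, 1 - conj (f 0) * f w ≠ 0 := by
    intro w hw h
    have hw1 : ‖f w‖ ≤ 1 := by simpa using hmaps hw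
    have : ‖conj (f 0) * f w‖ = 1 := by rw [← sub_eq_zero.1 h, norm_one]
    rw [norm_mul, Complex.norm_conj] at this
    nlinarith [norm_nonneg (f 0), norm_nonneg (f w)]
  have hg : DifferentiableOn ℂ (fun w => (f w - f 0) / (1 - conj (f 0) * f w)) (ball 0 1) :=
    (hf.sub_const _).div ((hf.const_mul _).const_sub _) hne
  have hgm : MapsTo (fun w => (f w - f 0) / (1 - conj (f 0) * f w)) (ball 0 1)
      (closedBall 0 1) := by
    intro w hw
    have hw1 : ‖f w‖ ≤ 1 := by simpa using hmaps hw
    rw [mem_closedBall_zero_iff, norm_div, div_le_one (norm_pos_iff.2 (hne w hw)),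
      ← sq_le_sq₀ (norm_nonneg _) (norm_nonneg _), ← Complex.normSq_eq_norm_sq,
      ← Complex.normSq_eq_norm_sq]
    have e1 : Complex.normSq (f w) ≤ 1 := by
      rw [Complex.normSq_eq_norm_sq]; nlinarith [norm_nonneg (f w)]
    have e2 : Complex.normSq (f 0) ≤ 1 := by
      rw [Complex.normSq_eq_norm_sq]; nlinarith [norm_nonneg (f 0)]
    simp only [Complex.normSq_apply, Complex.sub_re, Complex.sub_im, Complex.mul_re,
      Complex.mul_im, Complex.conj_re, Complex.conj_im, Complex.one_re, Complex.one_im] at e1 e2 ⊢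
    -- `|1 - āw|² - |w - a|² = (1 - |a|²)(1 - |w|²)`.
    nlinarith [mul_nonneg (sub_nonneg.2 e1) (sub_nonneg.2 e2)]
  have := Complex.norm_le_norm_of_mapsTo_ball hg hgm (by simp) hz
  rwa [norm_div, div_le_iff₀ (norm_pos_iff.2 (hne z (by simpa using hz)))] at this

/-- A pseudohyperbolic disc is contained in a Euclidean disc. -/
theorem Complex.norm_sub_le_of_norm_sub_le_mul {a w : ℂ} {r : ℝ} (ha : ‖a‖ < 1) (hr0 : 0 ≤ r)
    (hr : r < 1) (h : ‖w - a‖ ≤ r * ‖1 - conj a * w‖) :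
    ‖w - ((1 - r ^ 2) / (1 - ‖a‖ ^ 2 * r ^ 2) : ℝ) * a‖
      ≤ r * (1 - ‖a‖ ^ 2) / (1 - ‖a‖ ^ 2 * r ^ 2) := by
  have ha2 : ‖a‖ ^ 2 < 1 := by nlinarith [norm_nonneg a]
  have hD : 0 < 1 - ‖a‖ ^ 2 * r ^ 2 := by nlinarith [sq_nonneg ‖a‖, sq_nonneg r]
  have hsq : Complex.normSq (w - a) ≤ r ^ 2 * Complex.normSq (1 - conj a * w) := by
    rw [Complex.normSq_eq_norm_sq, Complex.normSq_eq_norm_sq, ← mul_pow]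
    exact pow_le_pow_left₀ (norm_nonneg _) h 2
  have hDc : ((1 - ‖a‖ ^ 2 * r ^ 2 : ℝ) : ℂ) ≠ 0 := by exact_mod_cast hD.ne'
  have e : w - ((1 - r ^ 2) / (1 - ‖a‖ ^ 2 * r ^ 2) : ℝ) * a
      = ((1 - ‖a‖ ^ 2 * r ^ 2 : ℝ) * w - (1 - r ^ 2 : ℝ) * a) / (1 - ‖a‖ ^ 2 * r ^ 2 : ℝ) := by
    rw [Complex.ofReal_div, eq_div_iff hDc, sub_mul, mul_right_comm, div_mul_cancel₀ _ hDc]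
    ring
  rw [e, norm_div, Complex.norm_real, Real.norm_of_nonneg hD.le]
  refine div_le_div_of_nonneg_right ?_ hD.le
  have hR : 0 ≤ r * (1 - ‖a‖ ^ 2) := mul_nonneg hr0 (by linarith)
  rw [← sq_le_sq₀ (norm_nonneg _) hR, ← Complex.normSq_eq_norm_sq]
  have key : Complex.normSq ((1 - ‖a‖ ^ 2 * r ^ 2 : ℝ) * w - (1 - r ^ 2 : ℝ) * a)
      = (r * (1 - ‖a‖ ^ 2)) ^ 2 + (1 - ‖a‖ ^ 2 * r ^ 2) *
        (Complex.normSq (w - a) - r ^ 2 * Complex.normSq (1 - conj a * w)) := by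
    simp only [← Complex.normSq_eq_norm_sq, Complex.normSq_apply, Complex.sub_re, Complex.sub_im,
      Complex.mul_re, Complex.mul_im, Complex.conj_re, Complex.conj_im, Complex.one_re,
      Complex.one_im, Complex.ofReal_re, Complex.ofReal_im]
    ring
  rw [key]
  nlinarith [mul_nonneg hD.le (sub_nonneg.2 hsq)]

/-- Source of the constant `3`: it is the limit of `2β + β²` as `β → 1`. -/
theorem one_sub_add_div_add_div {β r s : ℝ} (hr : 0 < 1 + β * r) (hs : 0 < 1 + β * s) :
    1 - ((β + r) / (1 + β * r) + (β + s) / (1 + β * s) - β)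
      = (1 - β) * (1 - r - s - (2 * β + β ^ 2) * (r * s)) / ((1 + β * r) * (1 + β * s)) := by
  field_simp
  ring

theorem add_div_add_div_sub_lt_one {β r s : ℝ} (hβ : |β| < 1) (hr0 : 0 ≤ r) (hs0 : 0 ≤ s)
    (h : r + s + 3 * (r * s) < 1) :
    (β + r) / (1 + β * r) + (β + s) / (1 + β * s) - β < 1 := by
  obtain ⟨h1, h2⟩ := abs_lt.1 hβ
  have hrs := mul_nonneg hr0 hs0
  have hr : 0 < 1 + β * r := by nlinarith
  have hs : 0 < 1 + β * s := by nlinarith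
  rw [← sub_pos, one_sub_add_div_add_div hr hs]
  have : 0 < 1 - r - s - (2 * β + β ^ 2) * (r * s) := by
    have : (2 * β + β ^ 2) * (r * s) ≤ 3 * (r * s) :=
      mul_le_mul_of_nonneg_right (by nlinarith) hrs
    linarith
  have := sub_pos.2 h2
  positivity

theorem Complex.norm_add_sub_lt_one {a w₁ w₂ : ℂ} {r s : ℝ} (ha : ‖a‖ < 1) (hr0 : 0 ≤ r)
    (hs0 : 0 ≤ s) (h : r + s + 3 * (r * s) < 1) (h₁ : ‖w₁ - a‖ ≤ r * ‖1 - conj a * w₁‖)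
    (h₂ : ‖w₂ - a‖ ≤ s * ‖1 - conj a * w₂‖) : ‖w₁ + w₂ - a‖ < 1 := by
  have hrs := mul_nonneg hr0 hs0
  have hr : r < 1 := by linarith
  have hs : s < 1 := by linarith
  have d₁ := Complex.norm_sub_le_of_norm_sub_le_mul ha hr0 hr h₁
  have d₂ := Complex.norm_sub_le_of_norm_sub_le_mul ha hs0 hs h₂
  have hplus := add_div_add_div_sub_lt_one (β := ‖a‖) (by simpa using ha) hr0 hs0 h
  have hminus := add_div_add_div_sub_lt_one (β := -‖a‖) (by simpa using ha) hr0 hs0 h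
  -- The extreme point of the pseudohyperbolic disc is the Euclidean centre plus the Euclidean
  -- radius.
  have euc : ∀ β t : ℝ, |β| < 1 → 0 ≤ t → t < 1 → (β + t) / (1 + β * t)
      = β * ((1 - t ^ 2) / (1 - β ^ 2 * t ^ 2)) + t * (1 - β ^ 2) / (1 - β ^ 2 * t ^ 2) := by
    intro β t hβ ht0 ht1
    obtain ⟨hβ1, hβ2⟩ := abs_lt.1 hβ
    have e1 : 0 < 1 + β * t := by nlinarith
    have e2 : 0 < 1 - β * t := by nlinarith
    have e3 : 1 - β ^ 2 * t ^ 2 = (1 + β * t) * (1 - β * t) := by ring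
    rw [e3]
    field_simp
    ring
  have haa : |‖a‖| < 1 := by simpa using ha
  have haa' : |-‖a‖| < 1 := by simpa using ha
  rw [euc _ _ haa hr0 hr, euc _ _ haa hs0 hs] at hplus
  rw [euc _ _ haa' hr0 hr, euc _ _ haa' hs0 hs, neg_sq] at hminus
  set k : ℝ := (1 - r ^ 2) / (1 - ‖a‖ ^ 2 * r ^ 2)
  set l : ℝ := (1 - s ^ 2) / (1 - ‖a‖ ^ 2 * s ^ 2)
  have hsplit : w₁ + w₂ - a = (w₁ - k * a) + (w₂ - l * a) + ((k + l - 1 : ℝ) : ℂ) * a := by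
    push_cast
    ring
  have hlast : ‖((k + l - 1 : ℝ) : ℂ) * a‖ = |k + l - 1| * ‖a‖ := by
    rw [norm_mul, Complex.norm_real, Real.norm_eq_abs]
  rw [hsplit]
  refine norm_add₃_le.trans_lt ?_
  rw [hlast]
  -- The sign of `k + l - 1` decides whether `β = ‖a‖` or `β = -‖a‖` gives the bound.
  rcases abs_cases (k + l - 1) with ⟨e, -⟩ | ⟨e, -⟩ <;> rw [e] <;> nlinarith

theorem Complex.norm_add_sub_lt_of_mapsTo_ball {f g : ℂ → ℂ} {M : ℝ}
    (hf : DifferentiableOn ℂ f (ball 0 1)) (hg : DifferentiableOn ℂ g (ball 0 1))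
    (hfM : ∀ z, ‖z‖ < 1 → ‖f z‖ ≤ M) (hgM : ∀ z, ‖z‖ < 1 → ‖g z‖ ≤ M) (hfg : f 0 = g 0)
    (h0 : ‖f 0‖ < M) {z w : ℂ} (hzw : ‖z‖ + ‖w‖ + 3 * (‖z‖ * ‖w‖) < 1) :
    ‖f z + g w - f 0‖ < M := by
  have hM : 0 < M := (norm_nonneg _).trans_lt h0
  have hz0 := norm_nonneg z
  have hw0 := norm_nonneg w
  have hp := mul_nonneg hz0 hw0
  have pick : ∀ k : ℂ → ℂ, DifferentiableOn ℂ k (ball 0 1) → (∀ z, ‖z‖ < 1 → ‖k z‖ ≤ M) →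
      k 0 = f 0 → ∀ y, ‖y‖ < 1 →
      ‖k y / M - f 0 / M‖ ≤ ‖y‖ * ‖1 - conj (f 0 / M) * (k y / M)‖ := by
    intro k hk hkM hk0 y hy
    rw [← hk0]
    refine Complex.norm_sub_le_mul_of_mapsTo_ball (f := fun x => k x / M) (hk.div_const _) ?_ ?_ hy
    · intro x hx
      rw [mem_closedBall_zero_iff, norm_div, Complex.norm_real, Real.norm_of_nonneg hM.le,
        div_le_one hM]
      exact hkM x (by simpa using hx)
    · rw [norm_div, Complex.norm_real, Real.norm_of_nonneg hM.le, div_lt_one hM, hk0]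
      exact h0
  have key := Complex.norm_add_sub_lt_one (a := f 0 / M) (w₁ := f z / M) (w₂ := g w / M)
    (by rwa [norm_div, Complex.norm_real, Real.norm_of_nonneg hM.le, div_lt_one hM]) hz0 hw0 hzw
    (pick f hf hfM rfl z (by linarith)) (pick g hg hgM hfg.symm w (by linarith))
  rwa [← add_div, ← sub_div, norm_div, Complex.norm_real, Real.norm_of_nonneg hM.le,
    div_lt_one hM] at key

/-! ### Functions on the crossed discs and their extensions. -/

theorem HolomorphicOnSet.differentiableOn_comp {n : ℕ} {V : Set (Fin n → ℂ)} {f : V → ℂ}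
    (hf : HolomorphicOnSet f) {E : Type*} [NormedAddCommGroup E] [NormedSpace ℂ E] {s : Set E}
    (hs : IsOpen s) {φ : E → Fin n → ℂ} (hφ : Differentiable ℂ φ) {g : E → ℂ}
    (hg : ∀ z ∈ s, ∃ h : φ z ∈ V, f ⟨φ z, h⟩ = g z) : DifferentiableOn ℂ g s := by
  intro z hz
  obtain ⟨hV, -⟩ := hg z hz
  obtain ⟨U, hU, hzU, F, hF, hFf⟩ := hf ⟨φ z, hV⟩
  have hd : DifferentiableAt ℂ (F ∘ φ) z :=
    (hF.differentiableAt (hU.mem_nhds hzU)).comp z (hφ z)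
  refine (hd.congr_of_eventuallyEq ?_).differentiableWithinAt
  filter_upwards [hs.mem_nhds hz, (hU.preimage hφ.continuous).mem_nhds hzU] with y hy hyU
  obtain ⟨hyV, hyg⟩ := hg y hy
  rw [← hyg, Function.comp_apply, hFf ⟨φ y, hyV⟩ hyU]

/-- A holomorphic function on the crossed discs is a pair of holomorphic functions on the disc. -/
theorem HolomorphicOnSet.exists_differentiableOn_ball {f : crossedDiscs → ℂ}
    (hf : HolomorphicOnSet f) : ∃ f₁ f₂ : ℂ → ℂ,
      DifferentiableOn ℂ f₁ (ball 0 1) ∧ DifferentiableOn ℂ f₂ (ball 0 1) ∧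
      (∀ (z : ℂ) (hz : ‖z‖ < 1), f ⟨![z, 0], fst_mem_crossedDiscs hz⟩ = f₁ z) ∧
      (∀ (z : ℂ) (hz : ‖z‖ < 1), f ⟨![0, z], snd_mem_crossedDiscs hz⟩ = f₂ z) := by
  classical
  have h₁ : ∀ (z : ℂ) (hz : ‖z‖ < 1), f ⟨![z, 0], fst_mem_crossedDiscs hz⟩
      = if h : ‖z‖ < 1 then f ⟨![z, 0], fst_mem_crossedDiscs h⟩ else 0 := fun z hz => by simp [hz]
  have h₂ : ∀ (z : ℂ) (hz : ‖z‖ < 1), f ⟨![0, z], snd_mem_crossedDiscs hz⟩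
      = if h : ‖z‖ < 1 then f ⟨![0, z], snd_mem_crossedDiscs h⟩ else 0 := fun z hz => by simp [hz]
  refine ⟨_, _, ?_, ?_, h₁, h₂⟩
  · refine hf.differentiableOn_comp isOpen_ball (φ := fun z => ![z, 0]) ?_ fun z hz => ?_
    · refine differentiable_pi.2 fun i => ?_
      fin_cases i <;> simp
    · have hz : ‖z‖ < 1 := by simpa using hz
      exact ⟨fst_mem_crossedDiscs hz, h₁ z hz⟩
  · refine hf.differentiableOn_comp isOpen_ball (φ := fun z => ![0, z]) ?_ fun z hz => ?_
    · refine differentiable_pi.2 fun i => ?_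
      fin_cases i <;> simp
    · have hz : ‖z‖ < 1 := by simpa using hz
      exact ⟨snd_mem_crossedDiscs hz, h₂ z hz⟩

theorem holomorphicOnSet_crossExtension {f : crossedDiscs → ℂ} (hf : HolomorphicOnSet f)
    {G : Set (Fin 2 → ℂ)} (hG : G ⊆ bidisc) :
    HolomorphicOnSet fun x : G => crossExtension f ⟨x, hG x.2⟩ := by
  obtain ⟨f₁, f₂, d₁, d₂, h₁, h₂⟩ := hf.exists_differentiableOn_ball
  refine fun x => ⟨bidisc, isOpen_bidisc, hG x.2, fun y => f₁ (y 0) + f₂ (y 1) - f₁ 0, ?_,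
    fun y _ => (crossExtension_eq f f₁ f₂ h₁ h₂ ⟨y, hG y.2⟩).symm⟩
  have e₁ : DifferentiableOn ℂ (fun y : Fin 2 → ℂ => f₁ (y 0)) bidisc :=
    d₁.comp (Differentiable.differentiableOn (by fun_prop)) fun y hy => by simpa using hy.1
  have e₂ : DifferentiableOn ℂ (fun y : Fin 2 → ℂ => f₂ (y 1)) bidisc :=
    d₂.comp (Differentiable.differentiableOn (by fun_prop)) fun y hy => by simpa using hy.2
  exact (e₁.add e₂).sub_const _

theorem crossExtension_of_mem_crossedDiscs (f : crossedDiscs → ℂ) {x : Fin 2 → ℂ}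
    (hT : x ∈ crossedDiscs) (hx : x ∈ bidisc) : crossExtension f ⟨x, hx⟩ = f ⟨x, hT⟩ := by
  rcases hT with ⟨-, h⟩ | ⟨h, -⟩
  · have e : x = ![x 0, 0] := by ext i; fin_cases i <;> simp [h]
    simp only [crossExtension, h, add_sub_cancel_right]
    congr 2
    exact e.symm
  · have e : x = ![0, x 1] := by ext i; fin_cases i <;> simp [h]
    simp only [crossExtension, h, add_sub_cancel_left]
    congr 2
    exact e.symm

theorem crossExtension_of_forall_eq {f : crossedDiscs → ℂ} {c : ℂ} (h : ∀ y, f y = c)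
    (x : bidisc) : crossExtension f x = c := by
  simp [crossExtension, h]

theorem Complex.eq_of_norm_le_norm_center {k : ℂ → ℂ} (hk : DifferentiableOn ℂ k (ball 0 1))
    (hmax : ∀ z, ‖z‖ < 1 → ‖k z‖ ≤ ‖k 0‖) {z : ℂ} (hz : ‖z‖ < 1) : k z = k 0 :=
  Complex.eqOn_of_isPreconnected_of_isMaxOn_norm (convex_ball 0 1).isPreconnected
    isOpen_ball hk (mem_ball_self one_pos) (fun y hy => hmax y (by simpa using hy))
    (by simpa using hz)

theorem Hinf.norm_le {n : ℕ} {V : Set (Fin n → ℂ)} {f : Hinf V} {C : ℝ} (hC : 0 ≤ C)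
    (h : ∀ x, ‖(f : V →ᵇ ℂ) x‖ ≤ C) : ‖f‖ ≤ C :=
  (BoundedContinuousFunction.norm_le hC).2 h

theorem norm_crossExtension_lt (f : Hinf crossedDiscs)
    (hf : ¬ ∃ c : ℂ, ∀ y, (f : crossedDiscs →ᵇ ℂ) y = c) {x : Fin 2 → ℂ} (hx : x ∈ crossRegion) :
    ‖crossExtension (f : crossedDiscs →ᵇ ℂ) ⟨x, crossRegion_subset_bidisc hx⟩‖ < ‖f‖ := by
  obtain ⟨f₁, f₂, d₁, d₂, h₁, h₂⟩ :=
    HolomorphicOnSet.exists_differentiableOn_ball (f := (f : crossedDiscs →ᵇ ℂ)) f.2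
  have b : ∀ y, ‖(f : crossedDiscs →ᵇ ℂ) y‖ ≤ ‖f‖ := (f : crossedDiscs →ᵇ ℂ).norm_coe_le_norm
  have b₁ : ∀ z, ‖z‖ < 1 → ‖f₁ z‖ ≤ ‖f‖ := fun z hz => h₁ z hz ▸ b _
  have b₂ : ∀ z, ‖z‖ < 1 → ‖f₂ z‖ ≤ ‖f‖ := fun z hz => h₂ z hz ▸ b _
  have h0 : f₁ 0 = f₂ 0 := by rw [← h₁ 0 (by simp), ← h₂ 0 (by simp)]
  rw [crossExtension_eq _ f₁ f₂ h₁ h₂]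
  refine Complex.norm_add_sub_lt_of_mapsTo_ball d₁ d₂ b₁ b₂ h0 ?_ hx
  -- If `|f(0,0)| = ‖f‖`, the maximum principle makes `f` constant on each disc, hence constant.
  refine lt_of_le_of_ne (b₁ 0 (by simp)) fun hmax => hf ⟨f₁ 0, ?_⟩
  rw [← hmax] at b₁ b₂
  rintro ⟨y, hy | hy⟩
  · have e : y = ![y 0, 0] := by ext i; fin_cases i <;> simp [hy.2]
    rw [← Complex.eq_of_norm_le_norm_center d₁ b₁ hy.1, ← h₁ _ hy.1]
    congr 2
  · have e : y = ![0, y 1] := by ext i; fin_cases i <;> simp [hy.1]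
    rw [h0] at b₂ ⊢
    rw [← Complex.eq_of_norm_le_norm_center d₂ b₂ hy.2, ← h₂ _ hy.2]
    congr 2

theorem norm_crossExtension_le (f : Hinf crossedDiscs) {x : Fin 2 → ℂ} (hx : x ∈ crossRegion) :
    ‖crossExtension (f : crossedDiscs →ᵇ ℂ) ⟨x, crossRegion_subset_bidisc hx⟩‖ ≤ ‖f‖ := by
  by_cases hf : ∃ c : ℂ, ∀ y, (f : crossedDiscs →ᵇ ℂ) y = c
  · obtain ⟨c, hc⟩ := hf
    rw [crossExtension_of_forall_eq hc, ← hc ⟨_, fst_mem_crossedDiscs (z := 0) (by simp)⟩]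
    exact (f : crossedDiscs →ᵇ ℂ).norm_coe_le_norm _
  · exact (norm_crossExtension_lt f hf hx).le

/-! ### Extremal functions and sharpness of the region. -/

theorem Complex.norm_ofReal_add_div_le_one {a : ℝ} (ha0 : 0 ≤ a) (ha : a < 1) {z : ℂ}
    (hz : ‖z‖ < 1) : 1 + a * z ≠ 0 ∧ ‖(a + z) / (1 + a * z)‖ ≤ 1 := by
  have hne : 1 + a * z ≠ 0 := by
    intro h
    have h1 : ‖(a : ℂ) * z‖ = 1 := by
      rw [eq_neg_of_add_eq_zero_right h, norm_neg, norm_one]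
    rw [norm_mul, Complex.norm_real, Real.norm_of_nonneg ha0] at h1
    nlinarith [norm_nonneg z]
  refine ⟨hne, ?_⟩
  rw [norm_div, div_le_one (norm_pos_iff.2 hne), ← sq_le_sq₀ (norm_nonneg _) (norm_nonneg _),
    ← Complex.normSq_eq_norm_sq, ← Complex.normSq_eq_norm_sq]
  have e1 : Complex.normSq z ≤ 1 := by
    rw [Complex.normSq_eq_norm_sq]; nlinarith [norm_nonneg z]
  have e2 : a ^ 2 ≤ 1 := by nlinarith
  simp only [Complex.normSq_apply, Complex.add_re, Complex.add_im, Complex.mul_re,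
    Complex.mul_im, Complex.ofReal_re, Complex.ofReal_im, Complex.one_re, Complex.one_im] at e1 ⊢
  nlinarith [mul_nonneg (sub_nonneg.2 e1) (sub_nonneg.2 e2)]

/-- The witness is the Möbius map `m` sending `0` to `a`, used on both discs after rotations that
move `x 0` and `x 1` to their moduli. For `a < 1` close to `1` its extension is at least `1` at `x`.
-/
theorem exists_crossExtension_norm_ge {x : Fin 2 → ℂ} (hx : x ∈ bidisc)
    (h : 1 < ‖x 0‖ + ‖x 1‖ + 3 * (‖x 0‖ * ‖x 1‖)) : ∃ f : Hinf crossedDiscs,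
      (¬ ∃ c : ℂ, ∀ y, (f : crossedDiscs →ᵇ ℂ) y = c) ∧
      ‖f‖ ≤ ‖crossExtension (f : crossedDiscs →ᵇ ℂ) ⟨x, hx⟩‖ := by
  obtain ⟨a, ⟨ha0, ha1⟩, ha⟩ : ∃ a : ℝ, (0 < a ∧ a < 1) ∧
      1 - ‖x 0‖ - ‖x 1‖ - (2 * a + a ^ 2) * (‖x 0‖ * ‖x 1‖) < 0 := by
    have hcont : Tendsto (fun a : ℝ => 1 - ‖x 0‖ - ‖x 1‖ - (2 * a + a ^ 2) * (‖x 0‖ * ‖x 1‖))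
        (𝓝[<] 1) (𝓝 (1 - ‖x 0‖ - ‖x 1‖ - (2 * 1 + 1 ^ 2) * (‖x 0‖ * ‖x 1‖))) :=
      (Continuous.tendsto (by fun_prop) 1).mono_left nhdsWithin_le_nhds
    exact (Filter.Eventually.and (Ioo_mem_nhdsLT zero_lt_one : ∀ᶠ a in 𝓝[<] (1 : ℝ), a ∈ Ioo 0 1)
      (hcont.eventually_lt_const (by linarith))).exists
  obtain ⟨u, hu, hux⟩ := Complex.exists_norm_eq_one_mul_eq_norm (x 0)
  obtain ⟨v, hv, hvx⟩ := Complex.exists_norm_eq_one_mul_eq_norm (x 1)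
  let m : ℂ → ℂ := fun z => (a + z) / (1 + a * z)
  have hm0 : m 0 = a := by simp [m]
  have hm : ∀ z : ℂ, ‖z‖ < 1 → 1 + a * z ≠ 0 ∧ ‖m z‖ ≤ 1 := fun z hz =>
    Complex.norm_ofReal_add_div_le_one ha0.le ha1 hz
  have hmd : DifferentiableOn ℂ m (ball 0 1) :=
    DifferentiableOn.div (by fun_prop) (by fun_prop) fun z hz => (hm z (by simpa using hz)).1
  let F : (Fin 2 → ℂ) → ℂ := fun y => m (u * y 0) + m (v * y 1) - a
  have hF : DifferentiableOn ℂ F bidisc := by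
    have e₁ : DifferentiableOn ℂ (fun y : Fin 2 → ℂ => m (u * y 0)) bidisc :=
      hmd.comp (Differentiable.differentiableOn (by fun_prop)) fun y hy => by
        simpa [hu] using hy.1
    have e₂ : DifferentiableOn ℂ (fun y : Fin 2 → ℂ => m (v * y 1)) bidisc :=
      hmd.comp (Differentiable.differentiableOn (by fun_prop)) fun y hy => by
        simpa [hv] using hy.2
    exact (e₁.add e₂).sub_const _
  have hTb : crossedDiscs ⊆ bidisc :=
    crossedDiscs_subset_crossRegion.trans crossRegion_subset_bidisc
  have hFT : ∀ y : crossedDiscs, ‖F y‖ ≤ 1 := by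
    rintro ⟨y, hy | hy⟩
    · simpa [F, hy.2, hm0] using (hm (u * y 0) (by simpa [hu] using hy.1)).2
    · simpa [F, hy.1, hm0] using (hm (v * y 1) (by simpa [hv] using hy.2)).2
  obtain ⟨f, hf⟩ := exists_mem_Hinf (fun y : crossedDiscs => F y)
    (fun y => ⟨bidisc, isOpen_bidisc, hTb y.2, F, hF, fun _ _ => rfl⟩) 1 hFT
  refine ⟨f, ?_, ?_⟩
  · rintro ⟨c, hc⟩
    have hhalf : ‖(1 / 2 : ℂ) * u⁻¹‖ < 1 := by
      rw [norm_mul, norm_inv, hu]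
      norm_num
    have hu0 : u ≠ 0 := norm_ne_zero_iff.1 (by simp [hu])
    have c0 := hc ⟨_, fst_mem_crossedDiscs (z := 0) (by simp)⟩
    have c1 := hc ⟨_, fst_mem_crossedDiscs hhalf⟩
    rw [hf] at c0 c1
    have hhalf' : u * ((1 / 2 : ℂ) * u⁻¹) = ((1 / 2 : ℝ) : ℂ) := by
      push_cast
      field_simp
    simp only [F, Matrix.cons_val_zero, Matrix.cons_val_one, mul_zero, hm0, hhalf'] at c0 c1
    -- Constancy would force `m(1/2) = m(0)`, that is `a² = 1`.
    have hreal : (a + 1 / 2) / (1 + a * (1 / 2)) = a := by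
      have : m ((1 / 2 : ℝ) : ℂ) = a := by linear_combination c1 - c0
      simp only [m] at this
      exact_mod_cast this
    rw [div_eq_iff (by positivity)] at hreal
    nlinarith
  · have hval : crossExtension (f : crossedDiscs →ᵇ ℂ) ⟨x, hx⟩
        = (((a + ‖x 0‖) / (1 + a * ‖x 0‖) + (a + ‖x 1‖) / (1 + a * ‖x 1‖) - a : ℝ) : ℂ) := by
      simp only [crossExtension, hf]
      simp [F, m, hux, hvx]
    have hle : ‖f‖ ≤ 1 := by
      refine Hinf.norm_le zero_le_one fun y => ?_
      rw [hf]
      exact hFT y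
    have hge : 1 ≤ (a + ‖x 0‖) / (1 + a * ‖x 0‖) + (a + ‖x 1‖) / (1 + a * ‖x 1‖) - a := by
      have e := one_sub_add_div_add_div (β := a) (r := ‖x 0‖) (s := ‖x 1‖)
        (by positivity) (by positivity)
      have : (1 - a) * (1 - ‖x 0‖ - ‖x 1‖ - (2 * a + a ^ 2) * (‖x 0‖ * ‖x 1‖))
          / ((1 + a * ‖x 0‖) * (1 + a * ‖x 1‖)) ≤ 0 :=
        div_nonpos_of_nonpos_of_nonneg
          (mul_nonpos_of_nonneg_of_nonpos (by linarith) ha.le) (by positivity)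
      linarith
    rw [hval, Complex.norm_real, Real.norm_of_nonneg (by linarith)]
    exact hle.trans hge

/-- If the defining expression is at least `1` at `x`, then at `t • x` with `t > 1` it is at least
`t`; so points outside the set accumulate at `x`. -/
theorem interior_setOf_norm_add_le_one :
    interior {x : Fin 2 → ℂ | ‖x 0‖ + ‖x 1‖ + 3 * (‖x 0‖ * ‖x 1‖) ≤ 1} ⊆ crossRegion := by
  intro x hx
  by_contra hxG
  have h1 : 1 ≤ ‖x 0‖ + ‖x 1‖ + 3 * (‖x 0‖ * ‖x 1‖) := not_lt.1 hxG
  have ht : Tendsto (fun t : ℝ => t • x) (𝓝[>] 1) (𝓝 x) := by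
    have : Tendsto (fun t : ℝ => t • x) (𝓝 1) (𝓝 ((1 : ℝ) • x)) :=
      Continuous.tendsto (by fun_prop) 1
    rw [one_smul] at this
    exact this.mono_left nhdsWithin_le_nhds
  obtain ⟨t, ht1, hmem⟩ := (Filter.Eventually.and
    (self_mem_nhdsWithin : ∀ᶠ t in 𝓝[>] (1 : ℝ), t ∈ Ioi 1) (ht.eventually (mem_interior_iff_mem_nhds.1 hx))).exists
  have ht1 : 1 < t := ht1
  simp only [Pi.smul_apply, norm_smul, Real.norm_of_nonneg (by linarith : 0 ≤ t)]
    at hmem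
  have hp := mul_nonneg (norm_nonneg (x 0)) (norm_nonneg (x 1))
  have hlt : t * 1 ≤ t * (‖x 0‖ + ‖x 1‖ + 3 * (‖x 0‖ * ‖x 1‖)) := by gcongr
  have h2 : t * (‖x 0‖ * ‖x 1‖) ≤ t * (t * (‖x 0‖ * ‖x 1‖)) :=
    le_mul_of_one_le_left (by positivity) ht1.le
  linarith

/-! ### Identification of the domain and the isometry. -/

theorem crossDomain_eq_crossRegion : crossDomain = crossRegion := by
  refine Subset.antisymm ?_ (interior_maximal (fun x hx => ⟨crossRegion_subset_bidisc hx,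
    fun f hf => norm_crossExtension_lt f hf hx⟩) isOpen_crossRegion)
  refine (interior_mono ?_).trans interior_setOf_norm_add_le_one
  rintro x ⟨hx, hlt⟩
  by_contra hgt
  obtain ⟨f, hf, hle⟩ := exists_crossExtension_norm_ge hx (not_le.1 hgt)
  exact (hlt f hf).not_ge hle

theorem exists_linearIsometry_crossExtension :
    ∃ E : Hinf crossedDiscs →ₗᵢ[ℂ] Hinf crossRegion, ∀ (f : Hinf crossedDiscs) (x : crossRegion),
      (E f : crossRegion →ᵇ ℂ) x
        = crossExtension (f : crossedDiscs →ᵇ ℂ) ⟨x, crossRegion_subset_bidisc x.2⟩ := by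
  choose e he using fun f : Hinf crossedDiscs => exists_mem_Hinf _
    (holomorphicOnSet_crossExtension (f := (f : crossedDiscs →ᵇ ℂ)) f.2 crossRegion_subset_bidisc)
    ‖f‖ fun x => norm_crossExtension_le f x.2
  let L : Hinf crossedDiscs →ₗ[ℂ] Hinf crossRegion :=
    { toFun := e
      map_add' := fun f g => by
        ext x
        simp only [Submodule.coe_add, BoundedContinuousFunction.coe_add, Pi.add_apply, he,
          crossExtension]
        ring
      map_smul' := fun c f => by
        ext x
        simp only [Submodule.coe_smul, BoundedContinuousFunction.coe_smul, he, crossExtension,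
          RingHom.id_apply, smul_eq_mul]
        ring }
  refine ⟨⟨L, fun f => le_antisymm ?_ ?_⟩, he⟩
  · refine Hinf.norm_le (norm_nonneg _) fun x => ?_
    exact (congrArg norm (he f x)).trans_le (norm_crossExtension_le f x.2)
  -- The extension restricts to `f` on the crossed discs, so its norm cannot be smaller.
  · refine Hinf.norm_le (norm_nonneg _) fun y => ?_
    have hy := crossedDiscs_subset_crossRegion y.2
    rw [← crossExtension_of_mem_crossedDiscs (f : crossedDiscs →ᵇ ℂ) y.2 (crossRegion_subset_bidisc hy),
      ← he f ⟨y, hy⟩]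
    exact (e f : crossRegion →ᵇ ℂ).norm_coe_le_norm _

theorem mainTheorem9 :
    ∃ G : Set (Fin 2 → ℂ),
      IsDomainOfHolomorphy G ∧ crossedDiscs ⊆ G ∧
      HasLinearNormPreservingExtension G crossedDiscs ∧
      G = crossDomain ∧
      ∃ (hG : G ⊆ bidisc) (E : Hinf crossedDiscs →ₗᵢ[ℂ] Hinf G),
        (∀ (f : Hinf crossedDiscs) (x : G),
          (E f : G →ᵇ ℂ) x = crossExtension (f : crossedDiscs →ᵇ ℂ) ⟨x, hG x.2⟩) ∧
        (∀ (f : Hinf crossedDiscs) (x : Fin 2 → ℂ) (hT : x ∈ crossedDiscs) (hx : x ∈ G),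
          (E f : G →ᵇ ℂ) ⟨x, hx⟩ = (f : crossedDiscs →ᵇ ℂ) ⟨x, hT⟩) := by
  obtain ⟨E, hE⟩ := exists_linearIsometry_crossExtension
  have hET : ∀ (f : Hinf crossedDiscs) (x : Fin 2 → ℂ) (hT : x ∈ crossedDiscs)
      (hx : x ∈ crossRegion), (E f : crossRegion →ᵇ ℂ) ⟨x, hx⟩ = (f : crossedDiscs →ᵇ ℂ) ⟨x, hT⟩ :=
    fun f x hT hx => (hE f ⟨x, hx⟩).trans (crossExtension_of_mem_crossedDiscs _ hT _)
  exact ⟨crossRegion, isDomainOfHolomorphy_crossRegion, crossedDiscs_subset_crossRegion,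
    ⟨⟨isDomainOfHolomorphy_crossRegion, isAnalyticSetIn_crossedDiscs⟩, E, hET⟩,
    crossDomain_eq_crossRegion.symm, crossRegion_subset_bidisc, E, hE, hET⟩
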